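/- **Theorem (Duality theorem).** All vector spaces are over $\mathbb{C}$. *Definitions.* A *field* on a vector space $M$ is a series $A(z)=\sum_{n\in\mathbb{Z}}A_{(n)}z^{-n-1}$ with $A_{(n)}\in\operatorname{End}M$ such that for each $v\in M$ one has $A_{(n)}v=0$ for $n\gg0$. A *field algebra* is a vector space $V$ with a vector $|0\rangle\neq0$, an operator $T\in\operatorname{End}V$ and a linear map $a\mapsto Y(a,z)=\sum_n a_{(n)}z^{-n-1}$ from $V$ to fields on $V$ such that $Y(|0\rangle,z)=I_V$; $Y(a,z)|0\rangle=a+T(a)z+\cdots\in V[[z]]$; $[T,Y(a,z)]=Y(Ta,z)=\partial_zY(a,z)$; and for all $a,b,c\in V$, $$(z-w)^N\,Y(Y(a,z)b,-w)c=(z-w)^N\,i_{z,w}Y(a,z-w)Y(b,-w)c\qquad\text{for } N\gg0,$$ where $i_{z,w}(z-w)^n=\sum_{j\ge0}\binom nj z^{n-j}(-w)^j$. A *$V$-module* is a vector space $M$ with an operator $T^M\in\operatorname{End}M$ and a linear map $a\mapsto Y^M(a,z)=\sum_n a^M_{(n)}z^{-n-1}$ from $V$ to fields on $M$ such that $Y^M(|0\rangle,z)=I_M$;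 $[T^M,Y^M(a,z)]=\partial_zY^M(a,z)$; and for all $a,b\in V$, $v\in M$, $$(z-w)^N\,Y^M(Y(a,z)b,-w)v=(z-w)^N\,i_{z,w}Y^M(a,z-w)Y^M(b,-w)v\qquad\text{for } N\gg0.$$ It is *irreducible* if $M\ne0$ and $0$ and $M$ are the only subspaces of $M$ stable under all $a^M_{(n)}$ ($a\in V$, $n\in\mathbb{Z}$). An *automorphism* of $V$ is an invertible linear map $g$ with $g|0\rangle=|0\rangle$ and $g(a_{(n)}b)=(ga)_{(n)}(gb)$ for all $a,b\in V$, $n\in\mathbb{Z}$. *Statement.* Let $V$ be a field algebra and $M$ an irreducible $V$-module. Let $G$ be a group with an action on $V$ by automorphisms and a linear representation in $M$ such that: 1. $g(a^M_{(n)}v)=(ga)^M_{(n)}(gv)$ for all $g\in G$, $a\in V$, $v\in M$, $n\in\mathbb{Z}$; 2. $V$ is a direct sum of irreducible $G$-modules; 3. $M$ is a direct sum of at most countably many finite-dimensional irreducible $G$-modules. Let $\pi$ be a finite-dimensional irreducible $G$-module whose isotypic component $M_\pi$ (the sum of all $G$-submodules of $M$ isomorphic to $\pi$) is non-zero. Then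 $M_\pi$ is irreducible with respect to the pair $(V^G,G)$, where $V^G=\{a\in V: ga=a \text{ for all } g\in G\}$ is the fixed point subalgebra: $M_\pi$ is stable under $G$ and under all $a^M_{(n)}$ with $a\in V^G$, $n\in\mathbb{Z}$, and $0$ and $M_\pi$ are its only subspaces stable under $G$ and all these operators. -/

import Mathlib

universe u v w x

/-! ### Formal distributions and the two sides of the associativity axiom

`VertexOperator ℂ M` is Mathlib's type of `End M`-valued fields (linear maps `M → M((z))`).  For a
field `A(z) = ∑ₙ A_(n) z^(-n-1)`, `VertexOperator.ncoeff A n` is the endomorphism `A_(n)`. -/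

/-- Multiplication by `z - w` on formal distributions
`f = ∑_{p,q ∈ ℤ} f p q • z ^ p * w ^ q` in `M[[z, z⁻¹, w, w⁻¹]]`. -/
def mulSub {M : Type v} [AddCommGroup M] (f : ℤ → ℤ → M) : ℤ → ℤ → M :=
  fun p q => f (p - 1) q - f p (q - 1)

section Associativity

variable {V : Type u} {M : Type v} [AddCommGroup V] [Module ℂ V] [AddCommGroup M] [Module ℂ M]

/-- The formal distribution `Y^M(Y(a, z) b, -w) v`: the coefficient of `z ^ p * w ^ q` is
`(-1) ^ q (a_(-p-1) b)_(-q-1) v`. -/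
noncomputable def iterateDistribution (Y : V →ₗ[ℂ] VertexOperator ℂ V)
    (YM : V →ₗ[ℂ] VertexOperator ℂ M) (a b : V) (v : M) : ℤ → ℤ → M :=
  fun p q => ((-1 : ℂ) ^ q) •
    (YM ((Y a).ncoeff (-p - 1) b)).ncoeff (-q - 1) v

/-- The formal distribution `i_{z,w} Y^M(a, z - w) Y^M(b, -w) v`.  Here
`i_{z,w} Y^M(a, z - w) = ∑_{n ∈ ℤ} ∑_{j ≥ 0} binom(n, j) z^(n-j) (-w)^j a_(-n-1)`, so that the
coefficient of `z ^ p * w ^ q` is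
`∑_{j ≥ 0} binom(p+j, j) (-1)^q a_(-(p+j)-1) b_(-(q-j)-1) v`.
Only finitely many terms are nonzero, see `productDistribution_support_finite`. -/
noncomputable def productDistribution (YM : V →ₗ[ℂ] VertexOperator ℂ M) (a b : V) (v : M) :
    ℤ → ℤ → M :=
  fun p q => ∑ᶠ j : ℕ, ((Ring.choose (p + j) j : ℤ) * (-1 : ℂ) ^ q) •
    (YM a).ncoeff (-(p + j) - 1) ((YM b).ncoeff (-(q - j) - 1) v)

theorem productDistribution_support_finite (YM : V →ₗ[ℂ] VertexOperator ℂ M) (a b : V) (v : M)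
    (p q : ℤ) :
    (Function.support fun j : ℕ => ((Ring.choose (p + j) j : ℤ) * (-1 : ℂ) ^ q) •
      (YM a).ncoeff (-(p + j) - 1) ((YM b).ncoeff (-(q - j) - 1) v)).Finite := by
  set d : ℤ := HahnSeries.order ((HahnModule.of ℂ).symm (YM b v)) with hd
  refine (Set.finite_Iic (q - d).toNat).subset fun j hj => ?_
  by_contra hlt
  refine hj ?_
  have h0 : (YM b).ncoeff (-(q - j) - 1) v = 0 := by
    refine VertexOperator.ncoeff_eq_zero_of_lt_order _ _ _ ?_
    rw [← hd]
    simp only [Set.mem_Iic, not_le] at hlt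
    omega
  simp only [h0, map_zero, smul_zero]

/-- The associativity axiom: for all `a, b ∈ V` and `v ∈ M`,
`(z - w)^N Y^M(Y(a, z) b, -w) v = (z - w)^N i_{z,w} Y^M(a, z - w) Y^M(b, -w) v` for `N ≫ 0`,
where "`N ≫ 0`" may depend on `a`, `b`, `v`. -/
def IsAssociative (Y : V →ₗ[ℂ] VertexOperator ℂ V) (YM : V →ₗ[ℂ] VertexOperator ℂ M) : Prop :=
  ∀ (a b : V) (v : M), ∃ N₀ : ℕ, ∀ N : ℕ, N₀ ≤ N →
    mulSub^[N] (iterateDistribution Y YM a b v) = mulSub^[N] (productDistribution YM a b v)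

end Associativity

/-! ### Field algebras -/

/-- A state-field correspondence on the vector space `V`. -/
structure StateFieldCorrespondence (V : Type u) [AddCommGroup V] [Module ℂ V] where
  /-- The vacuum vector. -/
  vac : V
  vac_ne_zero : vac ≠ 0
  /-- The map `a ↦ Y(a, z)`. -/
  Y : V →ₗ[ℂ] VertexOperator ℂ V
  /-- The translation operator. -/
  T : Module.End ℂ V
  /-- `Y(vac, z) = I`. -/
  vacuum_left : ∀ n : ℤ, (Y vac).ncoeff n = if n = -1 then 1 else 0
  /-- `Y(a, z) vac = a + T(a) z + ⋯ ∈ V[[z]]`. -/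
  vacuum_right_nonneg : ∀ (a : V) (n : ℤ), 0 ≤ n → (Y a).ncoeff n vac = 0
  vacuum_right_neg_one : ∀ a : V, (Y a).ncoeff (-1) vac = a
  vacuum_right_neg_two : ∀ a : V, (Y a).ncoeff (-2) vac = T a
  /-- `[T, Y(a, z)] = Y(T a, z)`. -/
  translation_commutator : ∀ (a : V) (n : ℤ),
    T * (Y a).ncoeff n - (Y a).ncoeff n * T = (Y (T a)).ncoeff n
  /-- `Y(T a, z) = ∂_z Y(a, z)`. -/
  translation_derivative : ∀ (a : V) (n : ℤ),
    (Y (T a)).ncoeff n = (-n : ℂ) • (Y a).ncoeff (n - 1)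

/-- A field algebra: a state-field correspondence satisfying the associativity axiom. -/
structure FieldAlgebra (V : Type u) [AddCommGroup V] [Module ℂ V] extends
    StateFieldCorrespondence V where
  associativity : IsAssociative Y Y

namespace FieldAlgebra

variable {V : Type u} [AddCommGroup V] [Module ℂ V] (A : FieldAlgebra V)

/-- The `n`-th product: `A.mode a n b` is `a_(n) b`. -/
noncomputable def mode (a : V) (n : ℤ) : Module.End ℂ V := (A.Y a).ncoeff n

/-- A subalgebra: a subspace containing the vacuum and closed under all `n`-th products. -/
structure Subalgebra where
  carrier : Submodule ℂ V
  vac_mem : A.vac ∈ carrier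
  mode_mem : ∀ {a b : V}, a ∈ carrier → b ∈ carrier → ∀ n : ℤ, A.mode a n b ∈ carrier

/-- The linear action `ρ` of the group `G` on `V` is by automorphisms of the field algebra. -/
structure ActsByAutomorphisms {G : Type w} [Group G] (ρ : Representation ℂ G V) : Prop where
  map_vac : ∀ g : G, ρ g A.vac = A.vac
  map_mode : ∀ (g : G) (a b : V) (n : ℤ), ρ g (A.mode a n b) = A.mode (ρ g a) n (ρ g b)

/-- The fixed point subalgebra `V^G`. -/
noncomputable def fixedPoints {G : Type w} [Group G] (ρ : Representation ℂ G V)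
    (hρ : A.ActsByAutomorphisms ρ) : A.Subalgebra where
  carrier := ρ.invariants
  vac_mem := fun g => hρ.map_vac g
  mode_mem := fun {a b} ha hb n g => by
    rw [hρ.map_mode, (Representation.mem_invariants ρ a).1 ha g,
      (Representation.mem_invariants ρ b).1 hb g]

end FieldAlgebra

/-! ### Modules over field algebras -/

/-- The structure on the vector space `M` of a module over the field algebra `A`. -/
structure FieldModule {V : Type u} [AddCommGroup V] [Module ℂ V] (A : FieldAlgebra V)
    (M : Type v) [AddCommGroup M] [Module ℂ M] where
  /-- The operator `T^M`. -/
  T : Module.End ℂ M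
  /-- The map `a ↦ Y^M(a, z)`. -/
  Y : V →ₗ[ℂ] VertexOperator ℂ M
  /-- `Y^M(vac, z) = I`. -/
  vacuum : ∀ n : ℤ, (Y A.vac).ncoeff n = if n = -1 then 1 else 0
  /-- `[T^M, Y^M(a, z)] = ∂_z Y^M(a, z)`. -/
  translation : ∀ (a : V) (n : ℤ),
    T * (Y a).ncoeff n - (Y a).ncoeff n * T = (-n : ℂ) • (Y a).ncoeff (n - 1)
  associativity : IsAssociative A.Y Y

namespace FieldModule

variable {V : Type u} [AddCommGroup V] [Module ℂ V] {A : FieldAlgebra V}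
  {M : Type v} [AddCommGroup M] [Module ℂ M] (𝓜 : FieldModule A M)

/-- `𝓜.mode a n v` is `a_(n) v`, for `a ∈ V` and `v ∈ M`. -/
noncomputable def mode (a : V) (n : ℤ) : Module.End ℂ M := (𝓜.Y a).ncoeff n

/-- The subspace `W` of `M` is stable under all `a_(n)` with `a` in the subspace `U` of `V`. -/
def IsStable (U : Submodule ℂ V) (W : Submodule ℂ M) : Prop :=
  ∀ a ∈ U, ∀ (n : ℤ), ∀ v ∈ W, 𝓜.mode a n v ∈ W

/-- Irreducibility of the `V`-module `M`: it is nonzero, and no proper nonzero subspace is stable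
under all operators `a_(n)`. -/
def IsIrreducible : Prop :=
  Nontrivial M ∧ ∀ W : Submodule ℂ M, 𝓜.IsStable ⊤ W → W = ⊥ ∨ W = ⊤

/-- The subspace `N` of `M` is irreducible with respect to the pair `(U, G)`, `U` a subalgebra of
`V` and `G` a group represented in `M`: it is nonzero, stable under `U` and `G`, and has no proper
nonzero subspace stable under `U` and `G`. -/
structure IsIrreducibleForPair (U : A.Subalgebra) {G : Type w} [Group G]
    (σ : Representation ℂ G M) (N : Submodule ℂ M) : Prop where
  ne_bot : N ≠ ⊥
  stable : 𝓜.IsStable U.carrier N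
  group_stable : ∀ g : G, ∀ v ∈ N, σ g v ∈ N
  eq_bot_or_eq : ∀ W : Submodule ℂ M, W ≤ N → 𝓜.IsStable U.carrier W →
    (∀ g : G, ∀ v ∈ W, σ g v ∈ W) → W = ⊥ ∨ W = N

end FieldModule

/-! ### Group representations -/

section GroupRepresentations

variable {G : Type w} [Group G] {V : Type u} [AddCommGroup V] [Module ℂ V]

open Classical in
/-- `V` is the (internal) direct sum of the set `𝒮` of irreducible subrepresentations. -/
def IsDirectSumOfIrreducibles (ρ : Representation ℂ G V) (𝒮 : Set (Subrepresentation ρ)) : Prop :=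
  DirectSum.IsInternal (fun S : 𝒮 => S.1.toSubmodule) ∧
    ∀ S ∈ 𝒮, S.toRepresentation.IsIrreducible

/-- The `π`-isotypic component of `ρ`: the sum of all subrepresentations isomorphic to `π`. -/
def isotypicPart {P : Type x} [AddCommGroup P] [Module ℂ P] (ρ : Representation ℂ G V)
    (π : Representation ℂ G P) : Submodule ℂ V :=
  ⨆ (S : Subrepresentation ρ) (_ : Nonempty (S.toRepresentation.Equiv π)), S.toSubmodule

end GroupRepresentations

/-! Associativity expresses a product `a_(m) b_(n)`, applied to finitely many vectors at once, as
one linear combination of single modes. Hence on a finite family of vectors the associative algebra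
generated by the modes acts through sums of modes (`modeAlgebra_mem_modeSpan`). It acts irreducibly
on `M`, whose dimension is countable, so Dixmier's lemma makes its commutant `ℂ`, and Jacobson
density yields every linear map `U → M` with `U` finite-dimensional (`iSup_range_mode_eq_top`).

Thus a sum of copies of `V` maps `G`-equivariantly onto `Hom(U, M)`. As `V` is semisimple,
invariants lift: every `G`-map `U → M` is a sum of modes of `V^G`. A nonzero stable `W ≤ M_π`
contains a copy `U` of `π`; such maps carry `U` onto every other copy, so `W = M_π`. -/

section Associativity

/-! ### Cancelling `(z - w)^N` and undoing `z ↦ z - w` -/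

theorem mulSub_iterate_mem {X : Type*} [AddCommGroup X] [Module ℂ X] (L : Submodule ℂ X)
    (f : ℤ → ℤ → X) (hf : ∀ p q, f p q ∈ L) (N : ℕ) (p q : ℤ) : mulSub^[N] f p q ∈ L := by
  induction N generalizing f with
  | zero => exact hf p q
  | succ N ih => exact ih _ fun p q => L.sub_mem (hf _ _) (hf _ _)

/-- Multiplication by `z - w` is injective modulo `L` on distributions bounded below in `w`. -/
theorem mem_of_mulSub_mem {X : Type*} [AddCommGroup X] [Module ℂ X] (L : Submodule ℂ X)
    (f : ℤ → ℤ → X) (d : ℤ) (hd : ∀ p q, q < d → f p q ∈ L) (hf : ∀ p q, mulSub f p q ∈ L)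
    (p q : ℤ) : f p q ∈ L := by
  -- Modulo `L`, `f p q` equals `f (p + 1) (q - 1)`, so membership propagates upwards in `q` from `d
  -- - 1`.
  have key : ∀ (n : ℕ) (p : ℤ), f p (d - 1 + n) ∈ L := by
    intro n
    induction n with
    | zero => intro p; exact hd _ _ (by simp)
    | succ n ih =>
      intro p
      have h1 : f p (d - 1 + (n + 1 : ℕ)) - f (p + 1) (d - 1 + n) ∈ L := by
        have h := hf (p + 1) (d - 1 + (n + 1 : ℕ))
        simp only [mulSub] at h
        convert h using 3
        · ring
        · push_cast; ring
      simpa using L.add_mem h1 (ih (p + 1))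
  rcases lt_or_ge q d with h | h
  · exact hd p q h
  · have h2 : q = d - 1 + ((q - d + 1).toNat : ℤ) := by omega
    rw [h2]
    exact key _ p

theorem mem_of_mulSub_iterate_mem {X : Type*} [AddCommGroup X] [Module ℂ X] (L : Submodule ℂ X)
    (f : ℤ → ℤ → X) (d : ℤ) (hd : ∀ p q, q < d → f p q ∈ L) (N : ℕ)
    (hf : ∀ p q, mulSub^[N] f p q ∈ L) : ∀ p q, f p q ∈ L := by
  induction N generalizing f with
  | zero => exact hf
  | succ N ih =>
    refine mem_of_mulSub_mem L f d hd (ih (mulSub f) (fun p q hq => ?_) hf)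
    exact L.sub_mem (hd _ _ hq) (hd _ _ (by omega))

theorem mulSub_iterate_apply {ι M : Type*} [AddCommGroup M] (f : ℤ → ℤ → ι → M) (N : ℕ) (p q : ℤ)
    (i : ι) : mulSub^[N] f p q i = mulSub^[N] (fun p q => f p q i) p q := by
  induction N generalizing f with
  | zero => rfl
  | succ N ih => exact ih (mulSub f)

/-- The substitution `z ↦ z - w` can be undone modulo `L` on distributions bounded below in `w`. -/
theorem mem_of_sum_choose_smul_mem {X : Type*} [AddCommGroup X] [Module ℂ X] (L : Submodule ℂ X)
    (x : ℤ → ℤ → X) (d : ℤ) (hd : ∀ p q, q < d → x p q ∈ L)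
    (hx : ∀ p q, ∑ j ∈ Finset.range ((q - d).toNat + 1),
      ((Ring.choose (p + j) j : ℤ) * (-1 : ℂ) ^ q) • x (p + j) (q - j) ∈ L) (p q : ℤ) :
    x p q ∈ L := by
  -- The system is triangular: the `j = 0` term is `(-1)^q • x p q`, and the others have smaller
  -- second index.
  have key : ∀ (n : ℕ) (p q : ℤ), q < d + n → x p q ∈ L := by
    intro n
    induction n with
    | zero => intro p q hq; exact hd _ _ (by simpa using hq)
    | succ n ih =>
      intro p q hq
      have h := hx p q
      rw [Finset.sum_range_succ'] at h
      have h1 := (L.add_mem_iff_right (L.sum_mem fun j _ => L.smul_mem _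
        (ih _ _ (by push_cast at hq ⊢; omega)))).1 h
      simp only [Nat.cast_zero, add_zero, Ring.choose_zero_right, Int.cast_one, one_mul,
        sub_zero] at h1
      exact (L.smul_mem_iff (zpow_ne_zero q (by norm_num))).1 h1
  exact key (q - d + 1).toNat p q (by omega)

end Associativity

/-! ### The algebra generated by the modes -/

namespace FieldModule

variable {V : Type*} [AddCommGroup V] [Module ℂ V] {A : FieldAlgebra V}
  {M : Type*} [AddCommGroup M] [Module ℂ M] (𝓜 : FieldModule A M)

/-- The `n`-th mode `a_(n)`, as a linear function of `a`. -/
noncomputable def modeLinear (n : ℤ) : V →ₗ[ℂ] Module.End ℂ M :=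
  LinearMap.proj n ∘ₗ VertexOperator.ncoeff ∘ₗ 𝓜.Y

theorem mode_vac : 𝓜.mode A.vac (-1) = 1 := by
  exact (𝓜.vacuum (-1)).trans (if_pos rfl)

/-- The span of all families `(a_(n) v_i)_i`. -/
noncomputable def modeSpan {ι : Type*} (v : ι → M) : Submodule ℂ (ι → M) :=
  ⨆ n : ℤ, LinearMap.range ((LinearMap.pi fun i => LinearMap.applyₗ (v i)) ∘ₗ 𝓜.modeLinear n)

theorem mode_mem_modeSpan {ι : Type*} (v : ι → M) (a : V) (n : ℤ) :
    (fun i => 𝓜.mode a n (v i)) ∈ 𝓜.modeSpan v :=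
  Submodule.mem_iSup_of_mem n ⟨a, rfl⟩

theorem self_mem_modeSpan {ι : Type*} (v : ι → M) : v ∈ 𝓜.modeSpan v := by
  simpa [mode_vac] using 𝓜.mode_mem_modeSpan v A.vac (-1)

theorem exists_mode_eq_zero {ι : Type*} [Finite ι] (v : ι → M) (b : V) :
    ∃ d : ℤ, ∀ q < d, ∀ i, 𝓜.mode b (-q - 1) (v i) = 0 := by
  cases nonempty_fintype ι
  have h : ∀ i, ∃ d : ℤ, ∀ q < d, 𝓜.mode b (-q - 1) (v i) = 0 := fun i =>
    ⟨_, fun q hq => VertexOperator.ncoeff_eq_zero_of_lt_order (𝓜.Y b) (-q - 1) (v i)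
      (by simpa using hq)⟩
  choose d hd using h
  obtain ⟨e, he⟩ := (Set.finite_range d).bddBelow
  exact ⟨e, fun q hq i => hd i q (hq.trans_le (he ⟨i, rfl⟩))⟩

/-- The iterate side of associativity has coefficients in `modeSpan v`. Both sides agree after
multiplication by a common `(z - w)^N`, which cancels modulo this span because the product side is
bounded below in `w`. Using families makes the combination of modes the same for all `v i`; density
needs this. -/
theorem mode_mode_mem_modeSpan {ι : Type*} [Finite ι] (v : ι → M) (a b : V) (m n : ℤ) :
    (fun i => 𝓜.mode a m (𝓜.mode b n (v i))) ∈ 𝓜.modeSpan v := by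
  cases nonempty_fintype ι
  obtain ⟨d, hd⟩ := 𝓜.exists_mode_eq_zero v b
  choose N₀ hN using fun i => 𝓜.associativity a b (v i)
  obtain ⟨N, hN₀⟩ := (Set.finite_range N₀).bddAbove
  let x : ℤ → ℤ → ι → M := fun p q i => 𝓜.mode a (-p - 1) (𝓜.mode b (-q - 1) (v i))
  have hx0 : ∀ p q, q < d → x p q = 0 := fun p q hq => funext fun i => by simp [x, hd q hq i]
  let Q : ℤ → ℤ → ι → M := fun p q i => productDistribution 𝓜.Y a b (v i) p q
  have hQ : ∀ p q, Q p q = ∑ j ∈ Finset.range ((q - d).toNat + 1),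
      ((Ring.choose (p + j) j : ℤ) * (-1 : ℂ) ^ q) • x (p + j) (q - j) := by
    intro p q
    funext i
    rw [Finset.sum_apply]
    refine finsum_eq_sum_of_support_subset _ fun j hj => ?_
    by_contra hlt
    refine hj ?_
    have := hd (q - j) (by simp at hlt; omega) i
    simp only [mode] at this
    simp only [this, map_zero, smul_zero]
  have hI : ∀ p q, (fun i => iterateDistribution A.Y 𝓜.Y a b (v i) p q) ∈ 𝓜.modeSpan v :=
    fun p q => (𝓜.modeSpan v).smul_mem _ (𝓜.mode_mem_modeSpan v _ _)
  have hQmem : ∀ p q, Q p q ∈ 𝓜.modeSpan v := by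
    refine mem_of_mulSub_iterate_mem _ Q d (fun p q hq => ?_) N fun p q => ?_
    · rw [hQ]
      refine Submodule.sum_mem _ fun j _ => ?_
      rw [hx0 _ _ (by omega), smul_zero]
      exact zero_mem _
    · convert mulSub_iterate_mem _ _ hI N p q using 1
      funext i
      rw [mulSub_iterate_apply, mulSub_iterate_apply]
      exact (congrFun₂ (hN i N (hN₀ ⟨i, rfl⟩)) p q).symm
  have := mem_of_sum_choose_smul_mem (𝓜.modeSpan v) x d
    (fun p q hq => by rw [hx0 p q hq]; exact zero_mem _) (fun p q => hQ p q ▸ hQmem p q)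
    (-m - 1) (-n - 1)
  simpa [x] using this

/-- The associative algebra of operators on `M` generated by all modes `a_(n)`. -/
noncomputable def modeAlgebra : Subalgebra ℂ (Module.End ℂ M) :=
  Algebra.adjoin ℂ {f | ∃ a n, f = 𝓜.mode a n}

theorem mode_mem_modeAlgebra (a : V) (n : ℤ) : 𝓜.mode a n ∈ 𝓜.modeAlgebra :=
  Algebra.subset_adjoin ⟨a, n, rfl⟩

/-- The span contains `v`, through the vacuum, and is stable under every mode, hence under the
algebra they generate. -/
theorem modeAlgebra_mem_modeSpan {ι : Type*} [Finite ι] (v : ι → M) {r : Module.End ℂ M}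
    (hr : r ∈ 𝓜.modeAlgebra) : (fun i => r (v i)) ∈ 𝓜.modeSpan v := by
  suffices ∀ w ∈ 𝓜.modeSpan v, (fun i => r (w i)) ∈ 𝓜.modeSpan v from
    this v (𝓜.self_mem_modeSpan v)
  induction hr using Algebra.adjoin_induction with
  | mem f hf =>
    obtain ⟨a, m, rfl⟩ := hf
    change 𝓜.modeSpan v ≤ (𝓜.modeSpan v).comap ((𝓜.mode a m).compLeft ι)
    refine iSup_le fun n => ?_
    rintro _ ⟨b, rfl⟩
    exact 𝓜.mode_mode_mem_modeSpan v a b m n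
  | algebraMap c => intro w hw; exact (𝓜.modeSpan v).smul_mem c hw
  | add f g _ _ hf hg => intro w hw; exact add_mem (hf w hw) (hg w hw)
  | mul f g _ _ hf hg => intro w hw; exact hf _ (hg w hw)

theorem IsIrreducible.isSimpleModule {𝓜 : FieldModule A M} (h : 𝓜.IsIrreducible) :
    IsSimpleModule 𝓜.modeAlgebra M := by
  have := h.1
  refine (isSimpleModule_iff _ _).2 ⟨fun W => ?_⟩
  have hW := h.2 (W.restrictScalars ℂ) fun a _ n v hv =>
    W.smul_mem (⟨_, 𝓜.mode_mem_modeAlgebra a n⟩ : 𝓜.modeAlgebra) hv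
  simpa using hW

end FieldModule

/-! ### Dixmier's lemma and density -/

open Polynomial in
/-- **Dixmier's lemma**: the endomorphisms of a simple module of small dimension over an
algebraically closed field are scalars. -/
theorem IsSimpleModule.exists_eq_algebraMap_of_rank_lt {K : Type u} {R : Type w} {M : Type v}
    [Field K] [IsAlgClosed K] [Ring R] [Algebra K R] [AddCommGroup M] [Module K M] [Module R M]
    [IsScalarTower K R M] [IsSimpleModule R M]
    (h : Cardinal.lift.{u} (Module.rank K M) < Cardinal.lift.{v} (Cardinal.mk K))
    (d : Module.End R M) : ∃ c : K, d = algebraMap K (Module.End R M) c := by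
  classical
  by_contra! hd
  have hX : ∀ a : K, aeval d (X - C a) ≠ 0 := fun a ha => hd a (by simpa [sub_eq_zero] using ha)
  have haeval : ∀ p : K[X], aeval d p = 0 → p = 0 := by
    intro p hp
    by_contra hp0
    have hint : IsIntegral K d := (show IsAlgebraic K d from ⟨p, hp0, hp⟩).isIntegral
    obtain ⟨c, hc⟩ := minpoly.mem_range_of_degree_eq_one K d
      (IsAlgClosed.degree_eq_one_of_irreducible K (minpoly.irreducible hint))
    exact hd c hc.symm
  obtain ⟨m, hm⟩ := @exists_ne M (IsSimpleModule.nontrivial R M) 0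
  -- By Schur's lemma each nonzero `d - a` is invertible. A relation among the `(d - a)⁻¹ m`,
  -- cleared of denominators, gives a polynomial `q` with `q(d) m = 0`, so `q = 0`; evaluating at
  -- `i` isolates `c i`.
  have hli : LinearIndependent K fun a : K => (aeval d (X - C a))⁻¹ m := by
    refine linearIndependent_iff'.2 fun s c hc i hi ↦ ?_
    let q : K[X] := ∑ a ∈ s, C (c a) * ∏ b ∈ s.erase a, (X - C b)
    have hq : q = 0 := by
      refine haeval q (of_not_not fun hne => hm ?_)
      refine LinearMap.injective_of_ne_zero hne ?_
      rw [map_zero, map_sum, LinearMap.sum_apply]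
      have := congrArg (aeval d (∏ b ∈ s, (X - C b))) hc
      rw [map_zero, map_sum] at this
      rw [← this]
      refine Finset.sum_congr rfl fun a ha => ?_
      rw [← Finset.prod_erase_mul _ _ ha, map_mul, map_mul, LinearMap.map_smul_of_tower,
        ← Module.End.mul_apply, mul_assoc, mul_inv_cancel₀ (hX a), mul_one, aeval_C,
        ← Algebra.smul_def]
      rfl
    have hi' := congrArg (eval i) hq
    rw [eval_finsetSum, Finset.sum_eq_single_of_mem i hi, eval_mul, eval_C, eval_prod,
      eval_zero] at hi'
    · refine (mul_eq_zero.1 hi').resolve_right (Finset.prod_ne_zero_iff.2 fun b hb => ?_)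
      simpa [sub_eq_zero] using (Finset.ne_of_mem_erase hb).symm
    · intro b _ hbi
      rw [eval_mul, eval_prod, Finset.prod_eq_zero (i := i) (Finset.mem_erase.2 ⟨hbi.symm, hi⟩)
        (by simp), mul_zero]
  exact absurd h (not_lt.2 hli.cardinal_lift_le_rank)

/-- The density theorem for simple modules of countable dimension. -/
theorem IsSimpleModule.exists_forall_mem_eq_smul {R M : Type*}
    [Ring R] [Algebra ℂ R] [AddCommGroup M] [Module ℂ M] [Module R M]
    [IsScalarTower ℂ R M] [IsSimpleModule R M] (h : Module.rank ℂ M ≤ Cardinal.aleph0)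
    (φ : Module.End ℂ M) (s : Finset M) : ∃ r : R, ∀ m ∈ s, φ m = r • m := by
  -- Density needs `φ` linear over the commutant, which consists of scalars.
  refine jacobson_density (R := R) { φ with map_smul' := fun d m => ?_ } s
  obtain ⟨c, rfl⟩ := IsSimpleModule.exists_eq_algebraMap_of_rank_lt (K := ℂ) (by
    rw [Cardinal.mk_complex]
    refine (Cardinal.lift_le.2 h).trans_lt ?_
    simpa using Cardinal.aleph0_lt_continuum) d
  exact φ.map_smul c m

/-! ### Semisimple representations and lifting of invariants -/

section Semisimple

open Representation

open scoped MonoidAlgebra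

variable {k G V : Type*} [Field k] [Group G] [AddCommGroup V] [Module k V]
  {ρ : Representation k G V}

/-- Invariants lift along a surjection from a sum of copies of a semisimple representation. -/
theorem Representation.mem_iSup_map_invariants {X ι : Type*} [AddCommGroup X] [Module k X]
    {τ : Representation k G X} [IsSemisimpleRepresentation ρ] (f : ι → IntertwiningMap ρ τ)
    (hf : ⨆ i, LinearMap.range (f i).toLinearMap = ⊤) {x : X} (hx : x ∈ τ.invariants) :
    x ∈ ⨆ i, ρ.invariants.map (f i).toLinearMap := by
  have := (isSemisimpleRepresentation_iff_isSemisimpleModule_asModule ρ).1 inferInstance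
  let F : (ι →₀ ρ.asModule) →ₗ[k[G]] τ.asModule :=
    Finsupp.lsum ℕ fun i => IntertwiningMap.equivLinearMapAsModule ρ τ (f i)
  have hF : Function.Surjective F := by
    intro y
    have hy : τ.asModuleEquiv y ∈ ⨆ i, LinearMap.range (f i).toLinearMap :=
      hf ▸ Submodule.mem_top
    obtain ⟨y, rfl⟩ := τ.asModuleEquiv.symm.surjective y
    rw [LinearEquiv.apply_symm_apply] at hy
    induction hy using Submodule.iSup_induction' with
    | mem i y hy =>
      obtain ⟨v, rfl⟩ := hy
      exact ⟨Finsupp.single i v, Finsupp.lsum_single ..⟩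
    | zero => exact ⟨0, map_zero F⟩
    | add y z _ _ hy hz =>
      obtain ⟨v, rfl⟩ := hy
      obtain ⟨w, rfl⟩ := hz
      exact ⟨v + w, map_add F v w⟩
  -- An equivariant section sends the invariant `x` to a family with invariant components.
  obtain ⟨s, hs⟩ := IsSemisimpleModule.lifting_property F hF LinearMap.id
  let y : τ.asModule := τ.asModuleEquiv.symm x
  have hx' : F (s y) = y := LinearMap.congr_fun hs y
  have hinv : ∀ i, ρ.asModuleEquiv (s y i) ∈ ρ.invariants := fun i g => by
    have h1 : MonoidAlgebra.single g (1 : k) • y = y :=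
      (Representation.single_smul τ 1 g y).trans ((one_smul k _).trans (hx g))
    have h2 : MonoidAlgebra.single g (1 : k) • s y = s y := by rw [← map_smul, h1]
    have h3 := DFunLike.congr_fun h2 i
    rw [Finsupp.smul_apply, Representation.single_smul, one_smul] at h3
    exact h3
  have hsum : x = ∑ i ∈ (s y).support, (f i).toLinearMap (ρ.asModuleEquiv (s y i)) := hx'.symm
  rw [hsum]
  exact Submodule.sum_mem _ fun i _ => Submodule.mem_iSup_of_mem i ⟨_, hinv i, rfl⟩

/-- The module of a subrepresentation is the corresponding submodule. -/
noncomputable def Subrepresentation.asModuleEquivAsSubmodule (S : Subrepresentation ρ) :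
    S.toRepresentation.asModule ≃ₗ[k[G]] S.asSubmodule :=
  let f := IntertwiningMap.equivLinearMapAsModule S.toRepresentation ρ
    (.mk S.toSubmodule.subtype fun _ => rfl)
  (LinearEquiv.ofInjective f Subtype.val_injective).trans <|
    LinearEquiv.ofEq _ _ <| SetLike.ext fun _ =>
      LinearMap.mem_range.trans
      ⟨fun ⟨y, hy⟩ => hy ▸ y.2, fun hx => ⟨⟨_, hx⟩, rfl⟩⟩

/-- Isomorphisms of representations are isomorphisms of modules over the group algebra. -/
noncomputable def Representation.Equiv.toAsModuleEquiv {W : Type*} [AddCommGroup W] [Module k W]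
    {τ : Representation k G W} (e : ρ.Equiv τ) : ρ.asModule ≃ₗ[k[G]] τ.asModule :=
  LinearEquiv.ofBijective (IntertwiningMap.equivLinearMapAsModule ρ τ e.toIntertwiningMap)
    e.toLinearEquiv.bijective

/-- Isomorphisms of modules over the group algebra are isomorphisms of representations. -/
noncomputable def Representation.Equiv.ofAsModule {W : Type*} [AddCommGroup W] [Module k W]
    {τ : Representation k G W} (e : ρ.asModule ≃ₗ[k[G]] τ.asModule) : ρ.Equiv τ :=
  IntertwiningMap.ofBijective ((IntertwiningMap.equivLinearMapAsModule ρ τ).symm e.toLinearMap)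
    e.bijective

theorem Subrepresentation.nonempty_equiv_iff {W : Type*} [AddCommGroup W] [Module k W]
    {τ : Representation k G W} (S : Subrepresentation ρ) :
    Nonempty (S.toRepresentation.Equiv τ) ↔ Nonempty (S.asSubmodule ≃ₗ[k[G]] τ.asModule) :=
  ⟨fun ⟨e⟩ => ⟨S.asModuleEquivAsSubmodule.symm.trans e.toAsModuleEquiv⟩,
    fun ⟨e⟩ => ⟨.ofAsModule (S.asModuleEquivAsSubmodule.trans e)⟩⟩

end Semisimple

/-! ### Direct sums of irreducibles and isotypic components -/

section DirectSum

open Representation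

open scoped MonoidAlgebra

variable {G V : Type*} [Group G] [AddCommGroup V] [Module ℂ V] {ρ : Representation ℂ G V}

theorem IsDirectSumOfIrreducibles.isSemisimpleModule {𝒮 : Set (Subrepresentation ρ)}
    (h : IsDirectSumOfIrreducibles ρ 𝒮) : IsSemisimpleModule ℂ[G] ρ.asModule := by
  classical
  refine IsSemisimpleModule.of_sSup_simples_eq_top (eq_top_iff.2 ?_)
  set N := sSup {m : Submodule ℂ[G] ρ.asModule | IsSimpleModule ℂ[G] m}
  have hle : ⨆ S : 𝒮, S.1.toSubmodule ≤ (Subrepresentation.ofSubmodule' N).toSubmodule := by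
    refine iSup_le fun S => ?_
    have := (irreducible_iff_isSimpleModule_asModule _).1 (h.2 S.1 S.2)
    exact (le_sSup (IsSimpleModule.congr S.1.asModuleEquivAsSubmodule.symm) :
      S.1.asSubmodule ≤ N)
  rw [h.1.submodule_iSup_eq_top] at hle
  exact fun x _ => hle (Submodule.mem_top (x := (x : V)))

theorem IsDirectSumOfIrreducibles.rank_le_aleph0 {𝒮 : Set (Subrepresentation ρ)}
    (h : IsDirectSumOfIrreducibles ρ 𝒮) (hc : 𝒮.Countable)
    (hfin : ∀ S ∈ 𝒮, FiniteDimensional ℂ S.toSubmodule) :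
    Module.rank ℂ V ≤ Cardinal.aleph0 := by
  classical
  have := hc.to_subtype
  let b (S : 𝒮) : Module.Basis (Fin (Module.finrank ℂ S.1.toSubmodule)) ℂ S.1.toSubmodule :=
    have := hfin S.1 S.2
    Module.finBasis ℂ S.1.toSubmodule
  rw [← (h.1.collectedBasis b).mk_eq_rank'']
  exact Cardinal.mk_le_aleph0

/-- The isotypic part of a representation is its isotypic component as a module over `ℂ[G]`. -/
theorem mem_isotypicPart_iff {P : Type*} [AddCommGroup P] [Module ℂ P] (π : Representation ℂ G P)
    (v : V) : v ∈ isotypicPart ρ π ↔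
      (show ρ.asModule from v) ∈ isotypicComponent ℂ[G] ρ.asModule π.asModule := by
  let I : Subrepresentation ρ := ⟨isotypicPart ρ π, fun g => by
    change isotypicPart ρ π ≤ (isotypicPart ρ π).comap (ρ g)
    exact iSup₂_le fun S hS x hx =>
      le_iSup₂ (f := fun (S : Subrepresentation ρ)
        (_ : Nonempty (S.toRepresentation.Equiv π)) => S.toSubmodule) S hS
        (S.apply_mem_toSubmodule g hx)⟩
  constructor
  · have : isotypicPart ρ π ≤ (Subrepresentation.ofSubmodule'
        (isotypicComponent ℂ[G] ρ.asModule π.asModule)).toSubmodule :=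
      iSup₂_le fun S hS => (le_sSup (S.nonempty_equiv_iff.1 hS) :
        S.asSubmodule ≤ isotypicComponent ℂ[G] ρ.asModule π.asModule)
    exact fun h => this h
  · have : isotypicComponent ℂ[G] ρ.asModule π.asModule ≤ I.asSubmodule :=
      sSup_le fun m hm =>
        le_iSup₂ (f := fun (S : Subrepresentation ρ)
          (_ : Nonempty (S.toRepresentation.Equiv π)) => S.toSubmodule)
          (Subrepresentation.ofSubmodule' m)
          ((Subrepresentation.nonempty_equiv_iff (Subrepresentation.ofSubmodule' m)).2 hm)
    exact fun h => this h

end DirectSum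

/-! ### Intertwiners as modes of fixed points, and duality -/

open Representation

open scoped MonoidAlgebra

namespace FieldModule

variable {V : Type*} [AddCommGroup V] [Module ℂ V] {A : FieldAlgebra V}
  {M : Type*} [AddCommGroup M] [Module ℂ M] {𝓜 : FieldModule A M}

/-- On a finite-dimensional subspace, every linear map is a combination of modes. -/
theorem IsIrreducible.iSup_range_mode_eq_top (hM : 𝓜.IsIrreducible)
    (hrank : Module.rank ℂ M ≤ Cardinal.aleph0) (U : Submodule ℂ M) [FiniteDimensional ℂ U] :
    ⨆ n : ℤ, LinearMap.range (LinearMap.lcomp ℂ M U.subtype ∘ₗ 𝓜.modeLinear n) = ⊤ := by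
  classical
  refine eq_top_iff.2 fun φ _ => ?_
  have := hM.isSimpleModule
  let b := Module.finBasis ℂ U
  let ev : (U →ₗ[ℂ] M) →ₗ[ℂ] (Fin (Module.finrank ℂ U) → M) := (b.constr ℂ).symm.toLinearMap
  have hev : Function.Injective ev := (b.constr ℂ).symm.injective
  -- Density concerns endomorphisms of `M`, so the map is first extended from `U`.
  obtain ⟨ψ, rfl⟩ := φ.exists_extend
  obtain ⟨r, hr⟩ := IsSimpleModule.exists_forall_mem_eq_smul (R := 𝓜.modeAlgebra) hrank ψ
    (Finset.univ.image fun i => (b i : M))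
  have h := 𝓜.modeAlgebra_mem_modeSpan (fun i => (b i : M)) r.2
  have h' : ev (ψ ∘ₗ U.subtype) ∈ 𝓜.modeSpan fun i => (b i : M) := by
    convert h using 1
    funext i
    exact hr _ (Finset.mem_image_of_mem _ (Finset.mem_univ i))
  have hspan : (𝓜.modeSpan fun i => (b i : M)) = Submodule.map ev
      (⨆ n : ℤ, LinearMap.range (LinearMap.lcomp ℂ M U.subtype ∘ₗ 𝓜.modeLinear n)) := by
    rw [Submodule.map_iSup]
    simp only [← LinearMap.range_comp]
    rfl
  rw [hspan, Submodule.mem_map] at h'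
  obtain ⟨χ, hχ, hχev⟩ := h'
  exact hev hχev ▸ hχ

variable {G : Type*} [Group G] {ρ : Representation ℂ G V} {σ : Representation ℂ G M}

/-- On a finite-dimensional subrepresentation, every intertwiner is a combination of modes of
fixed points. -/
theorem IsIrreducible.intertwiner_mem_iSup_map_invariants (hM : 𝓜.IsIrreducible)
    (hrank : Module.rank ℂ M ≤ Cardinal.aleph0) [IsSemisimpleRepresentation ρ]
    (hcompat : ∀ (g : G) (a : V) (n : ℤ) (v : M),
      σ g (𝓜.mode a n v) = 𝓜.mode (ρ g a) n (σ g v))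
    (U : Subrepresentation σ) [FiniteDimensional ℂ U.toSubmodule]
    (φ : IntertwiningMap U.toRepresentation σ) :
    φ.toLinearMap ∈ ⨆ n : ℤ, ρ.invariants.map
      (LinearMap.lcomp ℂ M U.toSubmodule.subtype ∘ₗ 𝓜.modeLinear n) := by
  -- `G` acts on `Hom(U, M)` by conjugation, and the intertwiners are its invariants.
  refine Representation.mem_iSup_map_invariants (τ := linHom U.toRepresentation σ)
    (fun n => ⟨LinearMap.lcomp ℂ M U.toSubmodule.subtype ∘ₗ 𝓜.modeLinear n, fun g => ?_⟩)
    (hM.iSup_range_mode_eq_top hrank U.toSubmodule) fun g => ?_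
  · ext a u
    change 𝓜.mode (ρ g a) n u = σ g (𝓜.mode a n (σ g⁻¹ u))
    rw [hcompat, ← Module.End.mul_apply (σ g), ← map_mul, mul_inv_cancel, map_one,
      Module.End.one_apply]
  · ext u
    change σ g (φ (U.toRepresentation g⁻¹ u)) = φ u
    rw [← φ.isIntertwining, ← Module.End.mul_apply, ← map_mul, mul_inv_cancel, map_one,
      Module.End.one_apply]

/-- A subspace stable under the modes of fixed points is stable under intertwiners from its
finite-dimensional subrepresentations. -/
theorem IsIrreducible.intertwiner_apply_mem (hM : 𝓜.IsIrreducible)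
    (hrank : Module.rank ℂ M ≤ Cardinal.aleph0) [IsSemisimpleRepresentation ρ]
    (hcompat : ∀ (g : G) (a : V) (n : ℤ) (v : M),
      σ g (𝓜.mode a n v) = 𝓜.mode (ρ g a) n (σ g v))
    {W : Submodule ℂ M} (hW : 𝓜.IsStable ρ.invariants W)
    (U : Subrepresentation σ) [FiniteDimensional ℂ U.toSubmodule] (hU : U.toSubmodule ≤ W)
    (φ : IntertwiningMap U.toRepresentation σ) (u : U.toSubmodule) : φ u ∈ W := by
  have hle : (⨆ n : ℤ, ρ.invariants.map
      (LinearMap.lcomp ℂ M U.toSubmodule.subtype ∘ₗ 𝓜.modeLinear n)) ≤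
      W.comap (LinearMap.applyₗ u) := by
    refine iSup_le fun n => ?_
    rintro _ ⟨a, ha, rfl⟩
    exact hW a ha n u (hU u.2)
  exact hle (hM.intertwiner_mem_iSup_map_invariants hrank hcompat U φ)

/-- Modes of fixed points commute with `G`, and equivariant endomorphisms preserve isotypic
components. -/
theorem isStable_isotypicPart
    (hcompat : ∀ (g : G) (a : V) (n : ℤ) (v : M),
      σ g (𝓜.mode a n v) = 𝓜.mode (ρ g a) n (σ g v))
    {P : Type*} [AddCommGroup P] [Module ℂ P] (π : Representation ℂ G P) [π.IsIrreducible] :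
    𝓜.IsStable ρ.invariants (isotypicPart σ π) := by
  intro a ha n v hv
  rw [mem_isotypicPart_iff] at hv ⊢
  let f : IntertwiningMap σ σ := ⟨𝓜.mode a n, fun g => by
    ext v
    have := hcompat g a n v
    rw [ha g] at this
    exact this.symm⟩
  have hle := LinearMap.le_comap_isotypicComponent π.asModule
    (IntertwiningMap.equivLinearMapAsModule σ σ f)
  exact hle hv

end FieldModule

theorem theorem7p2
    {V : Type*} [AddCommGroup V] [Module ℂ V] (A : FieldAlgebra V)
    {M : Type*} [AddCommGroup M] [Module ℂ M] (𝓜 : FieldModule A M)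
    (hM : 𝓜.IsIrreducible)
    {G : Type*} [Group G] (ρ : Representation ℂ G V) (σ : Representation ℂ G M)
    (hρ : A.ActsByAutomorphisms ρ)
    (hcompat : ∀ (g : G) (a : V) (n : ℤ) (v : M),
      σ g (𝓜.mode a n v) = 𝓜.mode (ρ g a) n (σ g v))
    (hV : ∃ 𝒮 : Set (Subrepresentation ρ), IsDirectSumOfIrreducibles ρ 𝒮)
    (hMG : ∃ 𝒮 : Set (Subrepresentation σ), 𝒮.Countable ∧ IsDirectSumOfIrreducibles σ 𝒮 ∧
      ∀ S ∈ 𝒮, FiniteDimensional ℂ S.toSubmodule)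
    {P : Type*} [AddCommGroup P] [Module ℂ P] [FiniteDimensional ℂ P]
    (π : Representation ℂ G P) (hπ : π.IsIrreducible)
    (hne : isotypicPart σ π ≠ ⊥) :
    𝓜.IsIrreducibleForPair (A.fixedPoints ρ hρ) σ (isotypicPart σ π) := by
  obtain ⟨𝒮, h𝒮⟩ := hV
  obtain ⟨𝒯, hc, h𝒯, hfin⟩ := hMG
  have hrank := h𝒯.rank_le_aleph0 hc hfin
  have hσ := h𝒯.isSemisimpleModule
  have := (isSemisimpleRepresentation_iff_isSemisimpleModule_asModule ρ).2 h𝒮.isSemisimpleModule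
  refine ⟨hne, FieldModule.isStable_isotypicPart hcompat π, fun g v hv => ?_, ?_⟩
  · rw [mem_isotypicPart_iff] at hv ⊢
    have := Submodule.smul_mem _ (MonoidAlgebra.single g (1 : ℂ)) hv
    rwa [Representation.single_smul, one_smul] at this
  intro W hWle hW hWG
  refine or_iff_not_imp_left.2 fun hW0 => le_antisymm hWle (iSup₂_le fun S ⟨e⟩ => ?_)
  let W' : Submodule ℂ[G] σ.asModule := Subrepresentation.asSubmodule ⟨W, hWG⟩
  obtain ⟨m, hmW, hm⟩ := (IsSemisimpleModule.eq_bot_or_exists_simple_le W').resolve_left fun h =>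
    hW0 ((Submodule.eq_bot_iff W).2 fun x hx => (Submodule.eq_bot_iff W').1 h x hx)
  have hmI : m ≤ isotypicComponent ℂ[G] σ.asModule π.asModule := fun x hx =>
    (mem_isotypicPart_iff π _).1 (hWle (hmW hx))
  let U := Subrepresentation.ofSubmodule' m
  obtain ⟨e'⟩ := U.nonempty_equiv_iff.2
    (isIsotypicOfType_submodule_iff.1 (.isotypicComponent ℂ[G] σ.asModule π.asModule) m hmI)
  have : FiniteDimensional ℂ U.toSubmodule := Module.Finite.equiv e'.toLinearEquiv.symm
  let ι : IntertwiningMap S.toRepresentation σ := ⟨S.toSubmodule.subtype, fun _ => rfl⟩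
  -- The composite `U ≅ π ≅ S ⊆ M` has image `S`.
  let φ : IntertwiningMap U.toRepresentation σ := ι.comp (e'.trans e.symm).toIntertwiningMap
  intro x hx
  have hφ := hM.intertwiner_apply_mem hrank hcompat hW U hmW φ ((e'.trans e.symm).symm ⟨x, hx⟩)
  have : (e'.trans e.symm) ((e'.trans e.symm).symm ⟨x, hx⟩) = ⟨x, hx⟩ :=
    Representation.Equiv.apply_symm_apply _ _
  change ((e'.trans e.symm) ((e'.trans e.symm).symm ⟨x, hx⟩) : M) ∈ W at hφ
  rwa [this] at hφ
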